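/- Let $q$ be a nonzero real number and $0\le s\le 1$. Let $\mathcal{O}(U_q(2))$ be the unital complex $*$-algebra generated by $u,\alpha,\gamma$ with relations: $u$ is a central unitary, $\alpha\gamma=q\gamma\alpha$, $\gamma\gamma^*=\gamma^*\gamma$, $\alpha\gamma^*=q\gamma^*\alpha$, $\alpha^*\alpha+\gamma\gamma^*=1$ and $\alpha\alpha^*+q^2\gamma\gamma^*=1$. It is a bialgebra, with $\Delta$ and $\varepsilon$ the $*$-homomorphisms given by $$\Delta(u)=u\otimes u,\quad \Delta(\alpha)=\alpha\otimes\alpha-q\gamma^*u^*\otimes\gamma,\quad \Delta(\gamma)=\gamma\otimes\alpha+\alpha^*u^*\otimes\gamma,\quad \varepsilon(u)=\varepsilon(\alpha)=1,\quad \varepsilon(\gamma)=0.$$ Set $$\xi=(1-s^2)\gamma\gamma^*+s(\gamma\alpha u+\alpha^*\gamma^*u^*),\qquad \zeta=(1-s^2)\alpha\gamma^*+s(\alpha^2u-q{\gamma^*}^2u^*),$$ let $J$ be the right ideal of $\mathcal{O}(U_q(2))$ generated by $\xi$, $\zeta-s$, $\zeta^*-s$ (it is a coideal), and let $\pi:\mathcal{O}(U_q(2))\to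 D:=\mathcal{O}(U_q(2))/J$ be the canonical map onto the quotient coalgebra. **Proposition.** The following elements $d_{m,n}$, $m,n\in\mathbb{Z}$, are group-like and form a basis of the complex vector space $D$ (products are taken from left to right, and the displayed equalities are part of the claim): $$d_{m,n}=\begin{cases}\pi\Big(u^m\prod_{k=1}^{n}\big(\alpha-q^{k}s\gamma^*u^*\big)\Big)=\pi\Big(u^m\prod_{k=0}^{n-1}\big(\alpha+q^{k}s\gamma\big)\Big), & n>0,\\[4pt] \pi(u^m), & n=0,\\[4pt] \pi\Big(u^m\prod_{k=0}^{-n-1}\big(\alpha^*+q^{1-k}s\gamma^*\big)\Big)=\pi\Big(u^m\prod_{k=0}^{-n-1}\big(\alpha^*-q^{-k}s\gamma u\big)\Big), & n<0.\end{cases}$$ Consequently there is an isomorphism of coalgebras from $D$ to $\mathcal{O}(\mathbb{T}^2)=\mathbb{C}[u_1^{\pm1},u_2^{\pm1}]$ (in which all monomials are group-like) mapping $d_{m,n}$ to $u_1^mu_2^n$ for all $m,n\in\mathbb{Z}$. -/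

import Mathlib

open scoped TensorProduct

noncomputable section

set_option linter.unusedSimpArgs false

namespace QuantumU2

/-- The names of the generators `u, u⋆, α, α⋆, γ, γ⋆`. -/
inductive Gen : Type
  | u | uStar | a | aStar | c | cStar

/-- The free unital complex algebra on the generators and their formal adjoints. -/
abbrev Free : Type := FreeAlgebra ℂ Gen

/-- A generator as an element of the free algebra. -/
abbrev Gen.ι (x : Gen) : Free := FreeAlgebra.ι ℂ x

open Gen in
/-- The defining relations of the `*`-algebra `𝒪(U_q(2))`, together with their adjoints:
`u` is a central unitary, `αγ = qγα`, `αγ⋆ = qγ⋆α`, `γγ⋆ = γ⋆γ`, `α⋆α + γγ⋆ = 1` and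
`αα⋆ + q²γγ⋆ = 1`. -/
inductive Rel (q : ℝ) : Free → Free → Prop
  | u_uStar : Rel q (u.ι * uStar.ι) 1
  | uStar_u : Rel q (uStar.ι * u.ι) 1
  | u_central (x : Gen) : Rel q (u.ι * x.ι) (x.ι * u.ι)
  | uStar_central (x : Gen) : Rel q (uStar.ι * x.ι) (x.ι * uStar.ι)
  | a_c : Rel q (a.ι * c.ι) ((q : ℂ) • (c.ι * a.ι))
  | cStar_aStar : Rel q (cStar.ι * aStar.ι) ((q : ℂ) • (aStar.ι * cStar.ι))
  | a_cStar : Rel q (a.ι * cStar.ι) ((q : ℂ) • (cStar.ι * a.ι))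
  | c_aStar : Rel q (c.ι * aStar.ι) ((q : ℂ) • (aStar.ι * c.ι))
  | c_cStar : Rel q (c.ι * cStar.ι) (cStar.ι * c.ι)
  | aStar_a : Rel q (aStar.ι * a.ι + c.ι * cStar.ι) 1
  | a_aStar : Rel q (a.ι * aStar.ι + (q : ℂ) ^ 2 • (c.ι * cStar.ι)) 1

/-- The algebra `𝒪(U_q(2))`. -/
def OU (q : ℝ) : Type := RingQuot (Rel q)

namespace OU

instance (q : ℝ) : Ring (OU q) := inferInstanceAs (Ring (RingQuot (Rel q)))

instance (q : ℝ) : Algebra ℂ (OU q) := inferInstanceAs (Algebra ℂ (RingQuot (Rel q)))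

/-- The canonical projection from the free algebra. -/
def mk (q : ℝ) : Free →ₐ[ℂ] OU q := RingQuot.mkAlgHom ℂ (Rel q)

/-- The image of a generator in `𝒪(U_q(2))`. -/
def gen (q : ℝ) (x : Gen) : OU q := mk q x.ι

lemma mk_rel {q : ℝ} {x y : Free} (h : Rel q x y) : mk q x = mk q y :=
  RingQuot.mkAlgHom_rel ℂ h

section relations

variable (q : ℝ)

lemma u_uStar : gen q .u * gen q .uStar = 1 := by
  simpa [gen] using mk_rel (Rel.u_uStar (q := q))

lemma uStar_u : gen q .uStar * gen q .u = 1 := by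
  simpa [gen] using mk_rel (Rel.uStar_u (q := q))

lemma u_central (x : Gen) : gen q .u * gen q x = gen q x * gen q .u := by
  simpa [gen] using mk_rel (Rel.u_central (q := q) x)

lemma uStar_central (x : Gen) : gen q .uStar * gen q x = gen q x * gen q .uStar := by
  simpa [gen] using mk_rel (Rel.uStar_central (q := q) x)

lemma a_c : gen q .a * gen q .c = (q : ℂ) • (gen q .c * gen q .a) := by
  have h := mk_rel (Rel.a_c (q := q))
  rwa [map_mul, map_smul, map_mul] at h

lemma cStar_aStar : gen q .cStar * gen q .aStar = (q : ℂ) • (gen q .aStar * gen q .cStar) := by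
  have h := mk_rel (Rel.cStar_aStar (q := q))
  rwa [map_mul, map_smul, map_mul] at h

lemma a_cStar : gen q .a * gen q .cStar = (q : ℂ) • (gen q .cStar * gen q .a) := by
  have h := mk_rel (Rel.a_cStar (q := q))
  rwa [map_mul, map_smul, map_mul] at h

lemma c_aStar : gen q .c * gen q .aStar = (q : ℂ) • (gen q .aStar * gen q .c) := by
  have h := mk_rel (Rel.c_aStar (q := q))
  rwa [map_mul, map_smul, map_mul] at h

lemma c_cStar : gen q .c * gen q .cStar = gen q .cStar * gen q .c := by
  simpa [gen] using mk_rel (Rel.c_cStar (q := q))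

lemma aStar_a : gen q .aStar * gen q .a = 1 - gen q .c * gen q .cStar := by
  rw [eq_sub_iff_add_eq]
  simpa [gen] using mk_rel (Rel.aStar_a (q := q))

lemma a_aStar : gen q .a * gen q .aStar = 1 - (q : ℂ) ^ 2 • (gen q .c * gen q .cStar) := by
  rw [eq_sub_iff_add_eq]
  have h := mk_rel (Rel.a_aStar (q := q))
  rwa [map_add, map_mul, map_smul, map_mul, map_one] at h

end relations

section lift

variable {q : ℝ} {B : Type*} [Ring B] [Algebra ℂ B]

/-- The universal property of `𝒪(U_q(2))`. -/
def lift (f : Gen → B)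
    (hf : ∀ ⦃x y : Free⦄, Rel q x y → FreeAlgebra.lift ℂ f x = FreeAlgebra.lift ℂ f y) :
    OU q →ₐ[ℂ] B :=
  RingQuot.liftAlgHom ℂ ⟨FreeAlgebra.lift ℂ f, hf⟩

@[simp]
lemma lift_gen (f : Gen → B)
    (hf : ∀ ⦃x y : Free⦄, Rel q x y → FreeAlgebra.lift ℂ f x = FreeAlgebra.lift ℂ f y)
    (x : Gen) : lift f hf (gen q x) = f x := by
  exact (RingQuot.liftAlgHom_mkAlgHom_apply ℂ _ hf _).trans (FreeAlgebra.lift_ι_apply f x)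

lemma algHom_ext {f g : OU q →ₐ[ℂ] B} (h : ∀ x, f (gen q x) = g (gen q x)) : f = g := by
  apply RingQuot.ringQuot_ext' ℂ
  apply FreeAlgebra.hom_ext
  funext x
  exact h x

end lift

/-! ### The involution -/

/-- The opposite algebra of `𝒪(U_q(2))` with conjugated scalars. -/
def ConjOp (q : ℝ) : Type := (OU q)ᵐᵒᵖ

instance (q : ℝ) : Ring (ConjOp q) := inferInstanceAs (Ring (OU q)ᵐᵒᵖ)

instance (q : ℝ) : Algebra ℂ (ConjOp q) :=
  RingHom.toAlgebra' ((algebraMap ℂ (OU q)ᵐᵒᵖ).comp (starRingEnd ℂ))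
    fun z x => Algebra.commutes (A := (OU q)ᵐᵒᵖ) (starRingEnd ℂ z) x

/-- The adjoint of a generator. -/
def _root_.QuantumU2.Gen.adj : Gen → Gen
  | .u => .uStar | .uStar => .u
  | .a => .aStar | .aStar => .a
  | .c => .cStar | .cStar => .c

/-- The bijection between `𝒪(U_q(2))` and its opposite. -/
def toConjOp (q : ℝ) (x : OU q) : ConjOp q := MulOpposite.op x

/-- The bijection between the opposite and `𝒪(U_q(2))`. -/
def ofConjOp {q : ℝ} (x : ConjOp q) : OU q := MulOpposite.unop (α := OU q) x

lemma toConjOp_mul (q : ℝ) (x y : OU q) : toConjOp q x * toConjOp q y = toConjOp q (y * x) := rfl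
lemma toConjOp_add (q : ℝ) (x y : OU q) : toConjOp q x + toConjOp q y = toConjOp q (x + y) := rfl
lemma toConjOp_one (q : ℝ) : toConjOp q 1 = 1 := rfl
lemma toConjOp_smul (q : ℝ) (z : ℂ) (x : OU q) :
    z • toConjOp q x = toConjOp q (starRingEnd ℂ z • x) := by
  rw [Algebra.smul_def, Algebra.smul_def, Algebra.commutes]
  rfl

/-- The involution as a homomorphism to the conjugate opposite algebra. -/
def starHom (q : ℝ) : OU q →ₐ[ℂ] ConjOp q :=
  lift (fun x => toConjOp q (gen q x.adj)) <| by
    intro x y h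
    cases h <;>
    simp only [map_mul, map_add, map_smul, map_one, FreeAlgebra.lift_ι_apply, Gen.adj,
      toConjOp_mul, toConjOp_add, toConjOp_smul, ← toConjOp_one, Complex.conj_ofReal, map_pow] <;>
    congr 1
    · exact u_uStar q
    · exact uStar_u q
    · exact (uStar_central q _).symm
    · exact (u_central q _).symm
    · exact cStar_aStar q
    · exact a_c q
    · exact c_aStar q
    · exact a_cStar q
    · exact (c_cStar q)
    · rw [aStar_a]; abel
    · rw [a_aStar]; abel

instance (q : ℝ) : Star (OU q) := ⟨fun x => ofConjOp (starHom q x)⟩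

lemma star_def (q : ℝ) (x : OU q) : star x = ofConjOp (starHom q x) := rfl

@[simp]
lemma star_gen (q : ℝ) (x : Gen) : star (gen q x) = gen q x.adj := by
  rw [star_def, starHom, lift_gen]; rfl

lemma star_smul' (q : ℝ) (z : ℂ) (x : OU q) : star (z • x) = starRingEnd ℂ z • star x := by
  rw [star_def, map_smul]
  exact congrArg ofConjOp (toConjOp_smul q z _)

lemma star_mul' (q : ℝ) (x y : OU q) : star (x * y) = star y * star x := by
  rw [star_def, map_mul]; rfl

lemma star_add' (q : ℝ) (x y : OU q) : star (x + y) = star x + star y := by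
  rw [star_def, map_add]; rfl

lemma star_one' (q : ℝ) : star (1 : OU q) = 1 := by
  rw [star_def, map_one]; rfl

/-- The square of the involution, as an algebra endomorphism. -/
def starStar (q : ℝ) : OU q →ₐ[ℂ] OU q where
  toFun x := star (star x)
  map_one' := by simp [star_one']
  map_mul' x y := by simp [star_mul']
  map_zero' := by
    have h : star (0 : OU q) = 0 := by simpa using star_smul' q 0 0
    rw [h, h]
  map_add' x y := by simp [star_add']
  commutes' z := by simp [Algebra.algebraMap_eq_smul_one, star_smul', star_one']

/-- `𝒪(U_q(2))` is a `*`-algebra. -/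
instance (q : ℝ) : StarRing (OU q) where
  star_involutive x := by
    have : starStar q = AlgHom.id ℂ (OU q) := algHom_ext fun x => by
      change star (star (gen q x)) = gen q x
      rw [star_gen, star_gen]; cases x <;> rfl
    exact DFunLike.congr_fun this x
  star_mul := star_mul' q
  star_add := star_add' q

instance (q : ℝ) : StarModule ℂ (OU q) where
  star_smul z x := star_smul' q z x

/-- The generator `u`. -/
def u (q : ℝ) : OU q := gen q .u

/-- The generator `α`. -/
def α (q : ℝ) : OU q := gen q .a

/-- The generator `γ`. -/
def γ (q : ℝ) : OU q := gen q .c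

/-- The generator `u` as an invertible element, with inverse `u⋆`. -/
def uUnit (q : ℝ) : (OU q)ˣ where
  val := u q
  inv := star (u q)
  val_inv := by simpa [u, Gen.adj] using u_uStar q
  inv_val := by simpa [u, Gen.adj] using uStar_u q

/-! ### The bialgebra structure -/

section comul

variable (q : ℝ)

lemma mul_mul_of {A : Type*} [Semigroup A] {x y z : A} (h : x * y = z) (w : A) :
    x * (y * w) = z * w := by
  rw [← mul_assoc, h]

/-- The values of the comultiplication on the generators. -/
def comulGen : Gen → OU q ⊗[ℂ] OU q
  | .u => u q ⊗ₜ u q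
  | .uStar => star (u q) ⊗ₜ star (u q)
  | .a => α q ⊗ₜ α q - (q : ℂ) • ((star (γ q) * star (u q)) ⊗ₜ γ q)
  | .aStar => star (α q) ⊗ₜ star (α q) - (q : ℂ) • ((γ q * u q) ⊗ₜ star (γ q))
  | .c => γ q ⊗ₜ α q + (star (α q) * star (u q)) ⊗ₜ γ q
  | .cStar => star (γ q) ⊗ₜ star (α q) + (α q * u q) ⊗ₜ star (γ q)

/-- The values of the counit on the generators. -/
def counitGen : Gen → ℂ
  | .u => 1 | .uStar => 1
  | .a => 1 | .aStar => 1
  | .c => 0 | .cStar => 0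

lemma comulGen_rel ⦃x y : Free⦄ (h : Rel q x y) :
    FreeAlgebra.lift ℂ (comulGen q) x = FreeAlgebra.lift ℂ (comulGen q) y := by
  have e1 := u_uStar q
  have e2 := uStar_u q
  have e3 := u_central q
  have e4 := uStar_central q
  cases h
  case' u_central x => cases x
  case' uStar_central x => cases x
  all_goals
    simp only [map_mul, map_add, map_smul, map_one, FreeAlgebra.lift_ι_apply,
      comulGen, u, α, γ, star_gen, Gen.adj, mul_add, add_mul, mul_sub, sub_mul,
      mul_smul_comm, smul_mul_assoc, Algebra.TensorProduct.tmul_mul_tmul, mul_assoc,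
      ← e3 .a, ← e3 .aStar, ← e3 .c, ← e3 .cStar, ← e4 .a, ← e4 .aStar, ← e4 .c, ← e4 .cStar,
      mul_mul_of (e3 .a).symm, mul_mul_of (e3 .aStar).symm,
      mul_mul_of (e3 .c).symm, mul_mul_of (e3 .cStar).symm,
      mul_mul_of (e4 .a).symm, mul_mul_of (e4 .aStar).symm,
      mul_mul_of (e4 .c).symm, mul_mul_of (e4 .cStar).symm,
      e1, e2, mul_mul_of e1, mul_mul_of e2, one_mul, mul_one,
      a_c, cStar_aStar, a_cStar, c_aStar, ← c_cStar, aStar_a, a_aStar,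
      TensorProduct.tmul_smul, ← TensorProduct.smul_tmul', TensorProduct.sub_tmul,
      TensorProduct.tmul_sub, Algebra.TensorProduct.one_def]
    try module

lemma counitGen_rel ⦃x y : Free⦄ (h : Rel q x y) :
    FreeAlgebra.lift ℂ counitGen x = FreeAlgebra.lift ℂ counitGen y := by
  cases h
  case u_central x => simp [mul_comm]
  case uStar_central x => simp [mul_comm]
  all_goals simp [counitGen, -Complex.coe_smul]

/-- The comultiplication: the algebra map with `Δ(u) = u ⊗ u`,
`Δ(α) = α ⊗ α - q γ⋆u⋆ ⊗ γ`, `Δ(γ) = γ ⊗ α + α⋆u⋆ ⊗ γ`, and compatible with adjoints. -/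
def comulHom : OU q →ₐ[ℂ] OU q ⊗[ℂ] OU q := lift (comulGen q) (comulGen_rel q)

/-- The counit: the algebra map with `ε(u) = ε(α) = 1` and `ε(γ) = 0`. -/
def counitHom : OU q →ₐ[ℂ] ℂ := lift counitGen (counitGen_rel q)

@[simp]
lemma comulHom_gen (x : Gen) : comulHom q (gen q x) = comulGen q x := lift_gen _ _ _

@[simp]
lemma counitHom_gen (x : Gen) : counitHom q (gen q x) = counitGen x := lift_gen _ _ _

end comul

/-- `𝒪(U_q(2))` is a bialgebra. -/
instance (q : ℝ) : Bialgebra ℂ (OU q) :=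
  Bialgebra.ofAlgHom (comulHom q) (counitHom q)
    (by
      apply algHom_ext
      intro x
      cases x <;>
      simp [comulGen, u, α, γ, Gen.adj, TensorProduct.tmul_add, TensorProduct.add_tmul,
        TensorProduct.tmul_sub, TensorProduct.sub_tmul, -Complex.coe_smul,
        TensorProduct.tmul_smul, ← TensorProduct.smul_tmul', sub_mul, add_mul, mul_assoc,
        u_uStar, uStar_u] <;>
      try module)
    (by
      apply algHom_ext
      intro x
      cases x <;>
      simp [comulGen, counitGen, u, α, γ, Gen.adj, -Complex.coe_smul])
    (by
      apply algHom_ext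
      intro x
      cases x <;>
      simp [comulGen, counitGen, u, α, γ, Gen.adj, -Complex.coe_smul])

lemma comul_apply (q : ℝ) (x : OU q) : Coalgebra.comul (R := ℂ) x = comulHom q x := rfl

lemma counit_apply (q : ℝ) (x : OU q) : Coalgebra.counit (R := ℂ) x = counitHom q x := rfl

/-! ### The Podleś sphere and the quotient coalgebra -/

/-- The self-adjoint generator `ξ` of the generic Podleś sphere. -/
def xi (q s : ℝ) : OU q :=
  (1 - (s : ℂ) ^ 2) • (γ q * star (γ q)) +
    (s : ℂ) • (γ q * α q * u q + star (α q) * star (γ q) * star (u q))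

/-- The generator `ζ` of the generic Podleś sphere. -/
def zeta (q s : ℝ) : OU q :=
  (1 - (s : ℂ) ^ 2) • (α q * star (γ q)) +
    (s : ℂ) • (α q ^ 2 * u q - (q : ℂ) • (star (γ q) ^ 2 * star (u q)))

/-- The right ideal generated by `ξ`, `ζ - s` and `ζ⋆ - s`. -/
def rightIdeal (q s : ℝ) : Submodule (OU q)ᵐᵒᵖ (OU q) :=
  Submodule.span (OU q)ᵐᵒᵖ
    {xi q s, zeta q s - algebraMap ℂ (OU q) s, star (zeta q s) - algebraMap ℂ (OU q) s}

/-- The same right ideal, as a complex subspace. -/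
def J (q s : ℝ) : Submodule ℂ (OU q) := (rightIdeal q s).restrictScalars ℂ

section coideal

variable (q s : ℝ)

lemma mem_J_of_mul {x : OU q} (hx : x ∈ J q s) (h : OU q) : x * h ∈ J q s :=
  (rightIdeal q s).smul_mem (MulOpposite.op h) hx

lemma xi_mem : xi q s ∈ J q s := Submodule.subset_span (by simp)

lemma zeta_mem : zeta q s - algebraMap ℂ (OU q) s ∈ J q s := Submodule.subset_span (by simp)

lemma starZeta_mem : star (zeta q s) - algebraMap ℂ (OU q) s ∈ J q s :=
  Submodule.subset_span (by simp)

lemma star_zeta : star (zeta q s) = (1 - (s : ℂ) ^ 2) • (γ q * star (α q)) +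
    (s : ℂ) • (star (α q) ^ 2 * star (u q) - (q : ℂ) • (γ q ^ 2 * u q)) := by
  have e3 := u_central q
  have e4 := uStar_central q
  simp only [zeta, star_add, star_smul, star_mul, star_sub, star_star, star_pow, sq,
    Complex.star_def, map_sub, map_mul, map_one, Complex.conj_ofReal, u, α, γ, star_gen, Gen.adj,
    mul_assoc, ← e3 .c, ← e4 .aStar, mul_mul_of (e3 .c).symm, mul_mul_of (e4 .aStar).symm]

/-- Right multiplication on the quotient by `J`. -/
def rightMul (h : OU q) : (OU q ⧸ J q s) →ₗ[ℂ] (OU q ⧸ J q s) :=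
  (J q s).mapQ (J q s) (LinearMap.mulRight ℂ h) fun _ hx => mem_J_of_mul q s hx h

/-- The tensor square of the quotient map. -/
def mkMk : OU q ⊗[ℂ] OU q →ₗ[ℂ] (OU q ⧸ J q s) ⊗[ℂ] (OU q ⧸ J q s) :=
  TensorProduct.map (J q s).mkQ (J q s).mkQ

lemma mkMk_mul {x : OU q ⊗[ℂ] OU q} (hx : mkMk q s x = 0) (t : OU q ⊗[ℂ] OU q) :
    mkMk q s (x * t) = 0 := by
  induction t using TensorProduct.induction_on with
  | zero => simp
  | add t₁ t₂ h₁ h₂ => rw [mul_add, map_add, h₁, h₂, add_zero]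
  | tmul a b =>
    have key : mkMk q s ∘ₗ LinearMap.mulRight ℂ (a ⊗ₜ[ℂ] b) =
        TensorProduct.map (rightMul q s a) (rightMul q s b) ∘ₗ mkMk q s := by
      ext c d
      simp only [mkMk, rightMul, TensorProduct.AlgebraTensorModule.curry_apply,
        LinearMap.restrictScalars_self, TensorProduct.curry_apply, LinearMap.comp_apply,
        LinearMap.mulRight_apply, Algebra.TensorProduct.tmul_mul_tmul, TensorProduct.map_tmul,
        Submodule.mkQ_apply, Submodule.mapQ_apply]
      rfl
    have := LinearMap.congr_fun key x
    simpa [hx] using this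

lemma mkMk_left {x : OU q} (hx : x ∈ J q s) (y : OU q) : mkMk q s (x ⊗ₜ y) = 0 := by
  simp [mkMk, (Submodule.Quotient.mk_eq_zero _).2 hx]

lemma mkMk_right {x : OU q} (hx : x ∈ J q s) (y : OU q) : mkMk q s (y ⊗ₜ x) = 0 := by
  simp [mkMk, (Submodule.Quotient.mk_eq_zero _).2 hx]

lemma comul_generators :
    (comulHom q (xi q s) =
      (1 - (1 + (q : ℂ) ^ 2) • (γ q * star (γ q))) ⊗ₜ xi q s +
      (γ q * α q * u q) ⊗ₜ (zeta q s - algebraMap ℂ (OU q) s) +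
      (star (α q) * star (γ q) * star (u q)) ⊗ₜ (star (zeta q s) - algebraMap ℂ (OU q) s) +
      xi q s ⊗ₜ 1) ∧
    (comulHom q (zeta q s) =
      (-(1 + (q : ℂ) ^ 2) • (α q * star (γ q))) ⊗ₜ xi q s +
      (α q ^ 2 * u q) ⊗ₜ (zeta q s - algebraMap ℂ (OU q) s) +
      (-(q : ℂ) • (star (γ q) ^ 2 * star (u q))) ⊗ₜ (star (zeta q s) - algebraMap ℂ (OU q) s) +
      zeta q s ⊗ₜ 1) ∧
    (comulHom q (star (zeta q s)) =
      (-(1 + (q : ℂ) ^ 2) • (γ q * star (α q))) ⊗ₜ xi q s +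
      (-(q : ℂ) • (γ q ^ 2 * u q)) ⊗ₜ (zeta q s - algebraMap ℂ (OU q) s) +
      (star (α q) ^ 2 * star (u q)) ⊗ₜ (star (zeta q s) - algebraMap ℂ (OU q) s) +
      star (zeta q s) ⊗ₜ 1) := by
  have e1 := u_uStar q
  have e2 := uStar_u q
  have e3 := u_central q
  have e4 := uStar_central q
  rw [star_zeta]
  refine ⟨?_, ?_, ?_⟩ <;>
  simp only [xi, zeta, sq, Algebra.algebraMap_eq_smul_one, map_mul, map_add, map_smul, map_one, neg_smul,
      TensorProduct.neg_tmul, 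
      map_sub, comulHom_gen, TensorProduct.tmul_add, TensorProduct.add_tmul, smul_add, smul_sub,
      comulGen, u, α, γ, star_gen, Gen.adj, mul_add, add_mul, mul_sub, sub_mul,
      mul_smul_comm, smul_mul_assoc, Algebra.TensorProduct.tmul_mul_tmul, mul_assoc,
      ← e3 .a, ← e3 .aStar, ← e3 .c, ← e3 .cStar, ← e4 .a, ← e4 .aStar, ← e4 .c, ← e4 .cStar,
      mul_mul_of (e3 .a).symm, mul_mul_of (e3 .aStar).symm,
      mul_mul_of (e3 .c).symm, mul_mul_of (e3 .cStar).symm,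
      mul_mul_of (e4 .a).symm, mul_mul_of (e4 .aStar).symm,
      mul_mul_of (e4 .c).symm, mul_mul_of (e4 .cStar).symm,
      e1, e2, mul_mul_of e1, mul_mul_of e2, one_mul, mul_one,
      a_c, cStar_aStar, a_cStar, c_aStar, ← c_cStar, aStar_a, a_aStar,
      TensorProduct.tmul_smul, ← TensorProduct.smul_tmul', TensorProduct.sub_tmul,
      TensorProduct.tmul_sub, Algebra.TensorProduct.one_def] <;>
  module

lemma mkMk_comul {x : OU q} (hx : x ∈ J q s) : mkMk q s (comulHom q x) = 0 := by
  obtain ⟨h₁, h₂, h₃⟩ := comul_generators q s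
  have hs : comulHom q (algebraMap ℂ (OU q) s) = algebraMap ℂ (OU q) s ⊗ₜ 1 :=
    (comulHom q).commutes _
  refine Submodule.span_induction (p := fun x _ => mkMk q s (comulHom q x) = 0)
    ?_ (by simp) ?_ ?_ hx
  · rintro y (rfl | rfl | rfl)
    · simp only [h₁, map_add, mkMk_right q s (xi_mem q s), mkMk_right q s (zeta_mem q s),
        mkMk_right q s (starZeta_mem q s), mkMk_left q s (xi_mem q s), add_zero]
    · rw [map_sub, hs, h₂, add_sub_assoc, ← TensorProduct.sub_tmul]
      simp only [map_add, mkMk_right q s (xi_mem q s), mkMk_right q s (zeta_mem q s),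
        mkMk_right q s (starZeta_mem q s), mkMk_left q s (zeta_mem q s), add_zero]
    · rw [map_sub, hs, h₃, add_sub_assoc, ← TensorProduct.sub_tmul]
      simp only [map_add, mkMk_right q s (xi_mem q s), mkMk_right q s (zeta_mem q s),
        mkMk_right q s (starZeta_mem q s), mkMk_left q s (starZeta_mem q s), add_zero]
  · intro y z _ _ hy hz
    rw [map_add, map_add, hy, hz, add_zero]
  · intro h y _ hy
    rw [← MulOpposite.op_unop h, MulOpposite.smul_eq_mul_unop, map_mul]
    exact mkMk_mul q s hy _

lemma counit_J {x : OU q} (hx : x ∈ J q s) : counitHom q x = 0 := by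
  refine Submodule.span_induction (p := fun x _ => counitHom q x = 0) ?_ (by simp) ?_ ?_ hx
  · rintro y (rfl | rfl | rfl)
    · simp [xi, u, α, γ, Gen.adj, counitGen, -Complex.coe_smul]
    · simp [zeta, u, α, γ, Gen.adj, counitGen, -Complex.coe_smul]
    · simp [star_zeta, u, α, γ, Gen.adj, counitGen, -Complex.coe_smul]
  · intro y z _ _ hy hz
    rw [map_add, hy, hz, add_zero]
  · intro h y _ hy
    rw [← MulOpposite.op_unop h, MulOpposite.smul_eq_mul_unop, map_mul, hy, zero_mul]

/-- The right ideal `J` is a coideal. -/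
instance : (J q s).IsCoideal where
  counit_eq_zero _ hx := counit_J q s hx
  map_mkQ_comul_eq_zero _ hx := mkMk_comul q s hx

end coideal

/-- The quotient coalgebra `D = 𝒪(U_q(2)) / J`, with the coalgebra structure induced from
`𝒪(U_q(2))`. -/
abbrev D (q s : ℝ) : Type := OU q ⧸ J q s

/-- The canonical coalgebra map `π : 𝒪(U_q(2)) → D`. -/
def π (q s : ℝ) : OU q →ₗc[ℂ] D q s := Coalgebra.Quotient.mkQCoalgHom (J q s)

end OU

/-- The product `x 0 * x 1 * ⋯ * x (n - 1)`, taken from left to right. -/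
def orderedProd {A : Type*} [Monoid A] (n : ℕ) (x : ℕ → A) : A :=
  ((List.range n).map x).prod

/-- The coordinate algebra `𝒪(𝕋²)` of the two-torus: Laurent polynomials in two variables
`u₁, u₂`, realised as the group algebra of `ℤ × ℤ`, with its usual coalgebra structure in which
every monomial is group-like. -/
abbrev OTorus2 : Type := AddMonoidAlgebra ℂ (ℤ × ℤ)

/-- The Laurent monomial `u₁ ^ m * u₂ ^ n`. -/
def torusMonomial (m n : ℤ) : OTorus2 := AddMonoidAlgebra.single (m, n) 1

end QuantumU2

end

open QuantumU2 (OU orderedProd OTorus2 torusMonomial)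
open QuantumU2.OU (u α γ uUnit D π)

noncomputable section

set_option linter.unusedSimpArgs false

namespace QuantumU2.OU

/-! Write `N = γ + qγ⋆u⋆`, `X_r = α + rγ`, `Y_r = α⋆ - rγu` and `Z_r = r(αu - α⋆) - (1 - r²)γu` for
`normalElt`, `raising`, `lowering` and `annihilator`. The quotient `D` is a right module over the
algebra, generated by `π(1)`, and the proof determines it as a ladder module.

The ideal `J` contains `Z_s` and `N` (`annihilator_mem`, `normalElt_mem`). Since `N` is normal
(`mul_normalElt`), it acts by zero on all of `D`. Modulo `N`, the identities `X_p Z_{qp} = q Z_p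
X_{qp}`, `X_p Y_{qp} = 1 - q Z_p γ` and their mirror images hold. Hence, starting from `π(1)`, which
`Z_s` kills, the factors `X` and `Y` produce vectors `v_n` (`n ∈ ℤ`) such that `v_n` is killed by
`Z_r` for `r = qⁿs`, while `X_r` and `Y_r` send `v_n` to `v_{n+1}` and `v_{n-1}`. The central
unitary `u` supplies the second index.

Group-likeness: `Δ(X_r)` and `Δ(Y_r)` differ from `X_r ⊗ X_r` and `Y_r ⊗ Y_r` by a tensor with a leg
that kills `v_n` (`comulHom_raising_lowering`).

Spanning: modulo `N` and `Z_r`, every generator acts on `v_n` through `X_r`, `Y_r`, `u` and `u⋆`.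
Solving for `γ` divides by `1 + r²`, nonzero because `r` is real (`gSpan_eq_top`).

Independence: the formulas so obtained, transposed, define a representation on functions on `ℤ × ℤ`.
Evaluation at the origin after acting vanishes on `J`, and so gives functionals on `D` separating
the vectors (`action_mem_J`, `linearIndependent_gRep`). -/

lemma ofReal_ne_zero {q : ℝ} (hq : q ≠ 0) : (q : ℂ) ≠ 0 := Complex.ofReal_ne_zero.2 hq

/-! ### Normal element, ladder elements and their identities -/

section elements

variable (q : ℝ)

/-- The normal element `γ + qγ⋆u⋆`. -/
def normalElt : OU q := γ q + (q : ℂ) • (star (γ q) * star (u q))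

/-- The factor `α + rγ` raising the second index. -/
def raising (r : ℂ) : OU q := α q + r • γ q

/-- The factor `α⋆ - rγu` lowering the second index. -/
def lowering (r : ℂ) : OU q := star (α q) - r • (γ q * u q)

/-- The element `r(αu - α⋆) - (1 - r²)γu`. -/
def annihilator (r : ℂ) : OU q :=
  r • (α q * u q - star (α q)) - (1 - r ^ 2) • (γ q * u q)

lemma gen_a_mul_c (w : OU q) :
    gen q .a * (gen q .c * w) = (q : ℂ) • (gen q .c * (gen q .a * w)) := by
  rw [← mul_assoc, a_c, smul_mul_assoc, mul_assoc]

lemma gen_a_mul_cStar (w : OU q) :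
    gen q .a * (gen q .cStar * w) = (q : ℂ) • (gen q .cStar * (gen q .a * w)) := by
  rw [← mul_assoc, a_cStar, smul_mul_assoc, mul_assoc]

lemma gen_c_mul_aStar (w : OU q) :
    gen q .c * (gen q .aStar * w) = (q : ℂ) • (gen q .aStar * (gen q .c * w)) := by
  rw [← mul_assoc, c_aStar, smul_mul_assoc, mul_assoc]

lemma gen_cStar_mul_aStar (w : OU q) :
    gen q .cStar * (gen q .aStar * w) = (q : ℂ) • (gen q .aStar * (gen q .cStar * w)) := by
  rw [← mul_assoc, cStar_aStar, smul_mul_assoc, mul_assoc]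

lemma gen_cStar_mul_c (w : OU q) :
    gen q .cStar * (gen q .c * w) = gen q .c * (gen q .cStar * w) := by
  rw [← mul_assoc, ← c_cStar, mul_assoc]

lemma gen_a_mul_aStar (w : OU q) :
    gen q .a * (gen q .aStar * w) = w - (q : ℂ) ^ 2 • (gen q .c * (gen q .cStar * w)) := by
  rw [← mul_assoc, a_aStar, sub_mul, one_mul, smul_mul_assoc, mul_assoc]

lemma gen_u_mul_uStar (w : OU q) : gen q .u * (gen q .uStar * w) = w := by
  rw [← mul_assoc, u_uStar, one_mul]

lemma gen_uStar_mul_u (w : OU q) : gen q .uStar * (gen q .u * w) = w := by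
  rw [← mul_assoc, uStar_u, one_mul]

lemma gen_mul_u (x : Gen) (w : OU q) :
    gen q x * (gen q .u * w) = gen q .u * (gen q x * w) := by
  rw [← mul_assoc, ← u_central, mul_assoc]

lemma gen_mul_uStar (x : Gen) (w : OU q) :
    gen q x * (gen q .uStar * w) = gen q .uStar * (gen q x * w) := by
  rw [← mul_assoc, ← uStar_central, mul_assoc]

/-- Commutation of the raising and lowering factors with the annihilators, and their products,
up to multiples of the normal element. -/
lemma raising_lowering_identities (p : ℂ) :
    (raising q p * annihilator q (q * p) =
      (q : ℂ) • (annihilator q p * raising q (q * p)) +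
        normalElt q * ((((q : ℂ) ^ 2 - 1) * p) • (γ q * u q))) ∧
    ((q : ℂ) • (lowering q (q * p) * annihilator q p) =
      annihilator q (q * p) * lowering q p +
        normalElt q * ((((q : ℂ) ^ 2 - 1) * p) • (γ q * u q ^ 2))) ∧
    (raising q p * lowering q (q * p) =
      1 - annihilator q p * ((q : ℂ) • γ q) - normalElt q * ((q : ℂ) • (γ q * u q))) ∧
    ((q : ℂ) • (lowering q (q * p) * raising q p) =
      (q : ℂ) • 1 - annihilator q (q * p) * γ q - normalElt q * (γ q * u q)) := by
  have e3 := u_central q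
  have e4 := uStar_central q
  refine ⟨?_, ?_, ?_, ?_⟩ <;>
  simp only [normalElt, raising, lowering, annihilator, sq, smul_add, smul_sub,
      u, α, γ, star_gen, Gen.adj, mul_add, add_mul, mul_sub, sub_mul, mul_smul_comm,
      smul_mul_assoc, mul_assoc, ← e3 .a, ← e3 .aStar, ← e3 .c, ← e3 .cStar,
      ← e4 .a, ← e4 .aStar, ← e4 .c, ← e4 .cStar,
      gen_mul_u q .a, gen_mul_u q .aStar, gen_mul_u q .c, gen_mul_u q .cStar,
      gen_mul_uStar q .a, gen_mul_uStar q .aStar, gen_mul_uStar q .c, gen_mul_uStar q .cStar,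
      gen_u_mul_uStar, gen_uStar_mul_u, u_uStar, uStar_u, mul_one, one_mul,
      gen_a_mul_c, gen_a_mul_cStar, gen_c_mul_aStar, gen_cStar_mul_aStar, gen_cStar_mul_c,
      gen_a_mul_aStar, a_c, cStar_aStar, a_cStar, c_aStar, ← c_cStar, aStar_a, a_aStar] <;>
  module

/-- On a vector killed by `annihilator q r` this recovers the action of `γu` from the two ladder
steps, provided `1 + r² ≠ 0`. -/
lemma smul_raising_sub_lowering (r : ℂ) :
    r • (raising q r * u q - lowering q r) = annihilator q r + (1 + r ^ 2) • (γ q * u q) := by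
  simp only [raising, lowering, annihilator, add_mul, smul_mul_assoc]
  module

/-- Both `γ` and `γ⋆` pick up the same factor when moved past a given generator: `q` past `α`, `q⁻¹`
past `α⋆`, and `1` past the others. -/
lemma mul_normalElt_gen (hq : q ≠ 0) (x : Gen) :
    ∃ h, gen q x * normalElt q = normalElt q * h := by
  have e3 := u_central q
  have e4 := uStar_central q
  have hq' : (q : ℂ) ≠ 0 := ofReal_ne_zero hq
  refine ⟨match x with
    | .a => (q : ℂ) • gen q .a
    | .aStar => (q : ℂ)⁻¹ • gen q .aStar
    | y => gen q y, ?_⟩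
  cases x <;>
  simp only [normalElt, smul_add, u, α, γ, star_gen, Gen.adj, mul_add, add_mul, mul_smul_comm,
      smul_mul_assoc, mul_assoc, ← e3 .a, ← e3 .aStar, ← e3 .c, ← e3 .cStar,
      ← e4 .a, ← e4 .aStar, ← e4 .c, ← e4 .cStar,
      gen_mul_u q .a, gen_mul_u q .aStar, gen_mul_u q .c, gen_mul_u q .cStar,
      gen_mul_uStar q .a, gen_mul_uStar q .aStar, gen_mul_uStar q .c, gen_mul_uStar q .cStar,
      gen_u_mul_uStar, gen_uStar_mul_u, u_uStar, uStar_u, mul_one, one_mul,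
      gen_a_mul_c, gen_a_mul_cStar, gen_c_mul_aStar, gen_cStar_mul_aStar, gen_cStar_mul_c,
      gen_a_mul_aStar, a_c, cStar_aStar, a_cStar, c_aStar, ← c_cStar, aStar_a, a_aStar]
  match_scalars <;> field_simp

/-- Elements of the right ideal generated by `ξ`, `ζ - s` and `ζ⋆ - s`, of lower degree than the
generators. -/
lemma ideal_identities (s : ℝ) :
    ((zeta q s - algebraMap ℂ (OU q) s) * star (α q) + xi q s * ((q : ℂ) ^ 3 • star (γ q)) =
      (s : ℂ) • (α q * u q - star (α q)) + ((q : ℂ) * (1 - (s : ℂ) ^ 2)) • star (γ q)) ∧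
    ((star (zeta q s) - algebraMap ℂ (OU q) s) * α q + xi q s * γ q =
      annihilator q s * -star (u q)) ∧
    ((q : ℂ) ^ 2 • xi q s - ((s : ℂ) • (α q * u q - star (α q)) +
        ((q : ℂ) * (1 - (s : ℂ) ^ 2)) • star (γ q)) * ((q : ℂ) • γ q) =
      normalElt q * ((s : ℂ) • star (α q))) ∧
    ((q : ℂ) • (zeta q s - algebraMap ℂ (OU q) s) - annihilator q s * ((q : ℂ) • α q) =
      normalElt q * (((q : ℂ) * (1 - (s : ℂ) ^ 2)) • (α q * u q)) -
        normalElt q * (((q : ℂ) * (s : ℂ)) • star (γ q))) ∧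
    (((s : ℂ) • (α q * u q - star (α q)) + ((q : ℂ) * (1 - (s : ℂ) ^ 2)) • star (γ q)) *
        star (u q) - annihilator q s * star (u q) = (1 - (s : ℂ) ^ 2) • normalElt q) ∧
    normalElt q * star (α q) * α q + normalElt q * star (γ q) * γ q = normalElt q := by
  have e3 := u_central q
  have e4 := uStar_central q
  have h : normalElt q * star (α q) * α q + normalElt q * star (γ q) * γ q = normalElt q := by
    rw [mul_assoc, mul_assoc, ← mul_add]
    simp only [α, γ, star_gen, Gen.adj, aStar_a, ← c_cStar, sub_add_cancel, mul_one]
  -- In the ordered word `α⋆γα` the middle factor blocks `α⋆α = 1 - γγ⋆`; the scalar `q` lets `γ`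
  -- move to the front first.
  have h' : (q : ℂ) • (gen q .aStar * (gen q .c * gen q .a)) =
      gen q .c - gen q .c * (gen q .c * gen q .cStar) := by
    rw [← gen_c_mul_aStar, aStar_a, mul_sub, mul_one]
  rw [star_zeta]
  refine ⟨?_, ?_, ?_, ?_, ?_, h⟩ <;>
  simp only [xi, zeta, normalElt, annihilator, sq, Algebra.algebraMap_eq_smul_one, smul_add,
      smul_sub, mul_neg, h', u, α, γ, star_gen, Gen.adj, mul_add, add_mul, mul_sub, sub_mul,
      mul_smul_comm, smul_mul_assoc, mul_assoc, ← e3 .a, ← e3 .aStar, ← e3 .c, ← e3 .cStar,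
      ← e4 .a, ← e4 .aStar, ← e4 .c, ← e4 .cStar,
      gen_mul_u q .a, gen_mul_u q .aStar, gen_mul_u q .c, gen_mul_u q .cStar,
      gen_mul_uStar q .a, gen_mul_uStar q .aStar, gen_mul_uStar q .c, gen_mul_uStar q .cStar,
      gen_u_mul_uStar, gen_uStar_mul_u, u_uStar, uStar_u, mul_one, one_mul,
      gen_a_mul_c, gen_a_mul_cStar, gen_c_mul_aStar, gen_cStar_mul_aStar, gen_cStar_mul_c,
      gen_a_mul_aStar, a_c, cStar_aStar, a_cStar, c_aStar, ← c_cStar, aStar_a, a_aStar] <;>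
  module

/-- The correction to group-likeness has one leg built from `annihilator q r` and `normalElt q`, so
it dies on vectors that `annihilator q r` kills. -/
lemma comulHom_raising_lowering (r : ℂ) :
    (comulHom q (raising q r) = raising q r ⊗ₜ raising q r -
      (annihilator q r * star (u q) + normalElt q) ⊗ₜ γ q) ∧
    (comulHom q (lowering q r) = lowering q r ⊗ₜ lowering q r -
      (γ q * u q) ⊗ₜ (normalElt q * u q + annihilator q r)) := by
  have e3 := u_central q
  have e4 := uStar_central q
  refine ⟨?_, ?_⟩ <;>
  simp only [raising, lowering, normalElt, annihilator, sq, smul_add, smul_sub,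
      map_mul, map_add, map_smul, map_sub, comulHom_gen, comulGen, TensorProduct.tmul_add,
      TensorProduct.add_tmul, TensorProduct.tmul_smul, ← TensorProduct.smul_tmul',
      TensorProduct.sub_tmul, TensorProduct.tmul_sub, Algebra.TensorProduct.tmul_mul_tmul,
      u, α, γ, star_gen, Gen.adj, mul_add, add_mul, mul_sub, sub_mul,
      mul_smul_comm, smul_mul_assoc, mul_assoc, ← e3 .a, ← e3 .aStar, ← e3 .c, ← e3 .cStar,
      ← e4 .a, ← e4 .aStar, ← e4 .c, ← e4 .cStar,
      gen_mul_u q .a, gen_mul_u q .aStar, gen_mul_u q .c, gen_mul_u q .cStar,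
      gen_mul_uStar q .a, gen_mul_uStar q .aStar, gen_mul_uStar q .c, gen_mul_uStar q .cStar,
      gen_u_mul_uStar, gen_uStar_mul_u, u_uStar, uStar_u, mul_one, one_mul,
      gen_a_mul_c, gen_a_mul_cStar, gen_c_mul_aStar, gen_cStar_mul_aStar, gen_cStar_mul_c,
      gen_a_mul_aStar, a_c, cStar_aStar, a_cStar, c_aStar, ← c_cStar, aStar_a, a_aStar] <;>
  module

end elements

lemma orderedProd_succ {A : Type*} [Monoid A] (n : ℕ) (x : ℕ → A) :
    orderedProd (n + 1) x = orderedProd n x * x n := by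
  simp [orderedProd, List.range_succ]

/-- An induction principle for `𝒪(U_q(2))`. -/
lemma induction_on {q : ℝ} {p : OU q → Prop} (x : OU q)
    (algebraMap : ∀ z : ℂ, p (algebraMap ℂ (OU q) z)) (gen : ∀ g, p (gen q g))
    (mul : ∀ x y, p x → p y → p (x * y)) (add : ∀ x y, p x → p y → p (x + y)) : p x := by
  obtain ⟨y, rfl⟩ := RingQuot.mkAlgHom_surjective ℂ (Rel q) x
  change p (mk q y)
  induction y using FreeAlgebra.induction with
  | grade0 z => simpa using algebraMap z
  | grade1 g => exact gen g
  | mul x y hx hy => rw [map_mul]; exact mul _ _ hx hy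
  | add x y hx hy => rw [map_add]; exact add _ _ hx hy

lemma mul_normalElt {q : ℝ} (hq : q ≠ 0) (x : OU q) :
    ∃ h, x * normalElt q = normalElt q * h := by
  induction x using induction_on with
  | algebraMap z => exact ⟨algebraMap ℂ _ z, Algebra.commutes _ _⟩
  | gen g => exact mul_normalElt_gen q hq g
  | mul x y hx hy =>
    obtain ⟨h, hx⟩ := hx
    obtain ⟨k, hy⟩ := hy
    exact ⟨h * k, by rw [mul_assoc, hy, ← mul_assoc, hx, mul_assoc]⟩
  | add x y hx hy =>
    obtain ⟨h, hx⟩ := hx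
    obtain ⟨k, hy⟩ := hy
    exact ⟨h + k, by rw [add_mul, hx, hy, mul_add]⟩

/-! ### The ladder of vectors in the quotient module -/

section quotient

variable {q s : ℝ}

lemma annihilator_mem (q s : ℝ) : annihilator q s ∈ J q s := by
  have h : annihilator q s * -star (u q) ∈ J q s := by
    rw [← (ideal_identities q s).2.1]
    exact (J q s).add_mem (mem_J_of_mul q s (starZeta_mem q s) _)
      (mem_J_of_mul q s (xi_mem q s) _)
  have hu : star (u q) * u q = 1 := (uUnit q).inv_val
  simpa [mul_assoc, hu] using mem_J_of_mul q s h (-u q)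

/-- Elements of `J` of low degree give `(1 - s²)N`, `sNα⋆` and `sNγ⋆` in `J`. Multiplying the last
two by `α` and `γ` and using `α⋆α + γ⋆γ = 1` yields `sN`. No division by `s` or `1 - s²` occurs, so
the endpoints need no separate treatment. -/
lemma normalElt_mem (hq : q ≠ 0) : normalElt q ∈ J q s := by
  have hq' : (q : ℂ) ≠ 0 := ofReal_ne_zero hq
  obtain ⟨h₁, -, h₃, h₄, h₅, h₆⟩ := ideal_identities q s
  have hx := xi_mem q s
  have hz := annihilator_mem q s
  have hw : (s : ℂ) • (α q * u q - star (α q)) +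
      ((q : ℂ) * (1 - (s : ℂ) ^ 2)) • star (γ q) ∈ J q s := by
    rw [← h₁]
    exact add_mem (mem_J_of_mul q s (zeta_mem q s) _) (mem_J_of_mul q s hx _)
  have k₁ : (1 - (s : ℂ) ^ 2) • normalElt q ∈ J q s := by
    rw [← h₅]
    exact sub_mem (mem_J_of_mul q s hw _) (mem_J_of_mul q s hz _)
  have k₂ : (s : ℂ) • (normalElt q * star (α q)) ∈ J q s := by
    rw [← mul_smul_comm, ← h₃]
    exact sub_mem ((J q s).smul_mem _ hx) (mem_J_of_mul q s hw _)
  have k₃ : (s : ℂ) • (normalElt q * star (γ q)) ∈ J q s := by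
    have h : normalElt q * (((q : ℂ) * (s : ℂ)) • star (γ q)) ∈ J q s := by
      rw [eq_sub_iff_add_eq, ← eq_sub_iff_add_eq'] at h₄
      rw [h₄]
      refine sub_mem ?_ (sub_mem ((J q s).smul_mem _ (zeta_mem q s)) (mem_J_of_mul q s hz _))
      have := mem_J_of_mul q s ((J q s).smul_mem (q : ℂ) k₁) (α q * u q)
      rwa [smul_smul, smul_mul_assoc, ← mul_smul_comm] at this
    rw [mul_smul_comm, mul_smul] at h
    exact ((J q s).smul_mem_iff hq').1 h
  have k₄ : (s : ℂ) • normalElt q ∈ J q s := by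
    rw [← h₆, smul_add, ← smul_mul_assoc,
      ← smul_mul_assoc _ (normalElt q * star (γ q))]
    exact add_mem (mem_J_of_mul q s k₂ _) (mem_J_of_mul q s k₃ _)
  have : normalElt q = (1 - (s : ℂ) ^ 2) • normalElt q + (s : ℂ) • (s : ℂ) • normalElt q := by
    module
  rw [this]
  exact add_mem k₁ ((J q s).smul_mem _ k₄)

lemma π_eq_zero {x : OU q} : π q s x = 0 ↔ x ∈ J q s := Submodule.Quotient.mk_eq_zero _

lemma π_surjective (v : D q s) : ∃ x, π q s x = v := Submodule.mkQ_surjective _ v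

lemma rightMul_π (h x : OU q) : rightMul q s h (π q s x) = π q s (x * h) := rfl

lemma rightMul_mul (h k : OU q) (v : D q s) :
    rightMul q s (h * k) v = rightMul q s k (rightMul q s h v) := by
  obtain ⟨x, rfl⟩ := π_surjective v
  simp only [rightMul_π, mul_assoc]

lemma rightMul_add (h k : OU q) (v : D q s) :
    rightMul q s (h + k) v = rightMul q s h v + rightMul q s k v := by
  obtain ⟨x, rfl⟩ := π_surjective v
  simp only [rightMul_π, mul_add, map_add]

lemma rightMul_sub (h k : OU q) (v : D q s) :
    rightMul q s (h - k) v = rightMul q s h v - rightMul q s k v := by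
  obtain ⟨x, rfl⟩ := π_surjective v
  simp only [rightMul_π, mul_sub, map_sub]

lemma rightMul_smul (z : ℂ) (h : OU q) (v : D q s) :
    rightMul q s (z • h) v = z • rightMul q s h v := by
  obtain ⟨x, rfl⟩ := π_surjective v
  simp only [rightMul_π, mul_smul_comm, map_smul]

lemma rightMul_one (v : D q s) : rightMul q s 1 v = v := by
  obtain ⟨x, rfl⟩ := π_surjective v
  simp only [rightMul_π, mul_one]

/-- Membership in `J` alone only controls `π(1)`; normality moves `N` to the left of any
representative, where the right ideal absorbs it. -/
lemma rightMul_normalElt (hq : q ≠ 0) (v : D q s) : rightMul q s (normalElt q) v = 0 := by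
  obtain ⟨x, rfl⟩ := π_surjective v
  obtain ⟨h, hx⟩ := mul_normalElt hq x
  rw [rightMul_π, hx, π_eq_zero]
  exact mem_J_of_mul q s (normalElt_mem hq) h

/-- The product of `|n|` raising or lowering factors representing the group-like element of
index `(0, n)`. -/
def rep (q s : ℝ) : ℤ → OU q
  | (n : ℕ) => orderedProd n fun k => raising q ((q : ℂ) ^ k * s)
  | .negSucc n => orderedProd (n + 1) fun k => lowering q ((q : ℂ) ^ (-(k : ℤ)) * s)

lemma rep_zero : rep q s 0 = 1 := rfl

lemma rep_natCast (n : ℕ) :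
    rep q s n = orderedProd n fun k => raising q ((q : ℂ) ^ k * s) := rfl

lemma rep_neg_natCast (n : ℕ) :
    rep q s (-n) = orderedProd n fun k => lowering q ((q : ℂ) ^ (-(k : ℤ)) * s) := by
  cases n <;> rfl

lemma rep_natCast_add_one (n : ℕ) :
    rep q s (n + 1) = rep q s n * raising q ((q : ℂ) ^ (n : ℤ) * s) := by
  rw [← Nat.cast_succ, rep_natCast, rep_natCast, orderedProd_succ, zpow_natCast]

lemma rep_neg_natCast_sub_one (n : ℕ) :
    rep q s (-n - 1) = rep q s (-n) * lowering q ((q : ℂ) ^ (-(n : ℤ)) * s) := by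
  rw [show (-n - 1 : ℤ) = -((n + 1 : ℕ) : ℤ) by push_cast; ring, rep_neg_natCast, rep_neg_natCast,
    orderedProd_succ]

lemma zpow_add_one_mul (hq : q ≠ 0) (n : ℤ) :
    (q : ℂ) ^ (n + 1) * s = q * ((q : ℂ) ^ n * s) := by
  rw [zpow_add_one₀ (ofReal_ne_zero hq)]; ring

lemma rightMul_annihilator_raising (hq : q ≠ 0) {p : ℂ} {v : D q s}
    (hv : rightMul q s (annihilator q p) v = 0) :
    rightMul q s (annihilator q (q * p)) (rightMul q s (raising q p) v) = 0 := by
  rw [← rightMul_mul, (raising_lowering_identities q p).1, rightMul_add, rightMul_smul,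
    rightMul_mul, rightMul_mul, hv, rightMul_normalElt hq]
  simp

lemma rightMul_annihilator_lowering (hq : q ≠ 0) {p : ℂ} {v : D q s}
    (hv : rightMul q s (annihilator q (q * p)) v = 0) :
    rightMul q s (annihilator q p) (rightMul q s (lowering q (q * p)) v) = 0 := by
  have h := congrArg (fun h => rightMul q s h v) (raising_lowering_identities q p).2.1
  simp only [rightMul_smul, rightMul_add, rightMul_mul, hv, rightMul_normalElt hq, map_zero,
    add_zero] at h
  exact (smul_eq_zero.1 h).resolve_left (ofReal_ne_zero hq)

lemma rightMul_lowering_raising (hq : q ≠ 0) {p : ℂ} {v : D q s}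
    (hv : rightMul q s (annihilator q p) v = 0) :
    rightMul q s (lowering q (q * p)) (rightMul q s (raising q p) v) = v := by
  rw [← rightMul_mul, (raising_lowering_identities q p).2.2.1, rightMul_sub, rightMul_sub,
    rightMul_mul, rightMul_mul, hv, rightMul_normalElt hq, rightMul_one]
  simp

lemma rightMul_raising_lowering (hq : q ≠ 0) {p : ℂ} {v : D q s}
    (hv : rightMul q s (annihilator q (q * p)) v = 0) :
    rightMul q s (raising q p) (rightMul q s (lowering q (q * p)) v) = v := by
  have h := congrArg (fun h => rightMul q s h v) (raising_lowering_identities q p).2.2.2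
  simp only [rightMul_smul, rightMul_sub, rightMul_mul, hv, rightMul_normalElt hq, map_zero,
    sub_zero, rightMul_one] at h
  exact smul_right_injective _ (ofReal_ne_zero hq) h

lemma rightMul_annihilator_rep (hq : q ≠ 0) (n : ℤ) :
    rightMul q s (annihilator q ((q : ℂ) ^ n * s)) (π q s (rep q s n)) = 0 := by
  induction n using Int.induction_on with
  | zero => simpa [rep_zero, rightMul_π, π_eq_zero] using annihilator_mem q s
  | succ n ih =>
    rw [zpow_add_one_mul hq, rep_natCast_add_one, ← rightMul_π]
    exact rightMul_annihilator_raising hq ih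
  | pred n ih =>
    have h := zpow_add_one_mul (s := s) hq (-(n : ℤ) - 1)
    rw [sub_add_cancel] at h
    rw [rep_neg_natCast_sub_one, ← rightMul_π, h]
    rw [h] at ih
    exact rightMul_annihilator_lowering hq ih

/-- For `n ≥ 0` this is how `rep` is built; for `n < 0` raising undoes the last lowering factor. -/
lemma rightMul_raising_rep (hq : q ≠ 0) (n : ℤ) :
    rightMul q s (raising q ((q : ℂ) ^ n * s)) (π q s (rep q s n)) = π q s (rep q s (n + 1)) := by
  induction n using Int.induction_on with
  | zero =>
    have h := rep_natCast_add_one (q := q) (s := s) 0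
    simp only [Nat.cast_zero] at h
    rw [h, rightMul_π]
  | succ n => rw [← Nat.cast_succ, rep_natCast_add_one, rightMul_π]
  | pred n =>
    have h := zpow_add_one_mul (s := s) hq (-(n : ℤ) - 1)
    have hZ := rightMul_annihilator_rep (s := s) hq (-(n : ℤ))
    rw [sub_add_cancel] at h
    rw [h] at hZ
    rw [rep_neg_natCast_sub_one, ← rightMul_π, sub_add_cancel, h]
    exact rightMul_raising_lowering hq hZ

lemma rightMul_lowering_rep (hq : q ≠ 0) (n : ℤ) :
    rightMul q s (lowering q ((q : ℂ) ^ n * s)) (π q s (rep q s n)) = π q s (rep q s (n - 1)) := by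
  have h := zpow_add_one_mul (s := s) hq (n - 1)
  have hZ := rightMul_annihilator_rep (s := s) hq (n - 1)
  rw [sub_add_cancel] at h
  have := rightMul_lowering_raising hq hZ
  rwa [rightMul_raising_rep hq, sub_add_cancel, ← h] at this

end quotient

/-! ### Group-like elements -/

section groupLike

variable {q s : ℝ}

lemma isGroupLikeElem_π_iff (x : OU q) : IsGroupLikeElem ℂ (π q s x) ↔
    counitHom q x = 1 ∧ mkMk q s (comulHom q x) = mkMk q s (x ⊗ₜ x) :=
  isGroupLikeElem_iff ℂ _

/-- The kernel of `π ⊗ π` is stable under right multiplication, so `Δ(x)` may be replaced by `x ⊗ x`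
in `Δ(x)Δ(h)`. -/
lemma isGroupLikeElem_π_mul {x h : OU q} (hx : IsGroupLikeElem ℂ (π q s x))
    (hε : counitHom q h = 1)
    (hΔ : mkMk q s ((x ⊗ₜ x) * comulHom q h) = mkMk q s ((x * h) ⊗ₜ (x * h))) :
    IsGroupLikeElem ℂ (π q s (x * h)) := by
  rw [isGroupLikeElem_π_iff] at hx ⊢
  refine ⟨by rw [map_mul, hx.1, hε, one_mul], ?_⟩
  rw [← hΔ, map_mul, ← sub_eq_zero, ← map_sub, ← sub_mul]
  exact mkMk_mul q s (by rw [map_sub, hx.2, sub_self]) _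

lemma isGroupLikeElem_one : IsGroupLikeElem ℂ (π q s 1) := by
  rw [isGroupLikeElem_π_iff, map_one, map_one]
  exact ⟨rfl, rfl⟩

lemma isGroupLikeElem_mul_raising (hq : q ≠ 0) {x : OU q} {r : ℂ}
    (hx : IsGroupLikeElem ℂ (π q s x)) (hZ : rightMul q s (annihilator q r) (π q s x) = 0) :
    IsGroupLikeElem ℂ (π q s (x * raising q r)) := by
  refine isGroupLikeElem_π_mul hx (by simp [raising, α, γ, counitGen]) ?_
  rw [(comulHom_raising_lowering q r).1, mul_sub, map_sub, Algebra.TensorProduct.tmul_mul_tmul,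
    Algebra.TensorProduct.tmul_mul_tmul, sub_eq_self]
  refine mkMk_left q s ?_ _
  rw [← π_eq_zero, ← rightMul_π, rightMul_add, rightMul_mul, hZ, rightMul_normalElt hq]
  simp

lemma isGroupLikeElem_mul_lowering (hq : q ≠ 0) {x : OU q} {r : ℂ}
    (hx : IsGroupLikeElem ℂ (π q s x)) (hZ : rightMul q s (annihilator q r) (π q s x) = 0) :
    IsGroupLikeElem ℂ (π q s (x * lowering q r)) := by
  refine isGroupLikeElem_π_mul hx (by simp [lowering, α, γ, counitGen, Gen.adj]) ?_
  rw [(comulHom_raising_lowering q r).2, mul_sub, map_sub, Algebra.TensorProduct.tmul_mul_tmul,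
    Algebra.TensorProduct.tmul_mul_tmul, sub_eq_self]
  refine mkMk_right q s ?_ _
  rw [← π_eq_zero, ← rightMul_π, rightMul_add, rightMul_mul, hZ, rightMul_normalElt hq]
  simp

lemma isGroupLikeElem_rep (hq : q ≠ 0) (n : ℤ) : IsGroupLikeElem ℂ (π q s (rep q s n)) := by
  induction n using Int.induction_on with
  | zero => exact isGroupLikeElem_one
  | succ n ih =>
    rw [rep_natCast_add_one]
    exact isGroupLikeElem_mul_raising hq ih (rightMul_annihilator_rep hq _)
  | pred n ih =>
    rw [rep_neg_natCast_sub_one]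
    exact isGroupLikeElem_mul_lowering hq ih (rightMul_annihilator_rep hq _)

lemma isGroupLikeElem_zpow (q : ℝ) (m : ℤ) :
    IsGroupLikeElem ℂ ((uUnit q ^ m : (OU q)ˣ) : OU q) := by
  have hu : IsGroupLikeElem ℂ (u q) := by
    constructor
    · simp [counit_apply, u, counitGen]
    · simp [comul_apply, u, comulGen]
  have hu' : IsGroupLikeElem ℂ (star (u q)) :=
    hu.of_mul_eq_one (uUnit q).val_inv (uUnit q).inv_val
  cases m with
  | ofNat n => simpa [uUnit] using hu.pow (n := n)
  | negSucc n => simpa [uUnit, zpow_negSucc, ← inv_pow] using hu'.pow (n := n + 1)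

/-- The representative of the group-like element of index `(m, n)`. -/
def gRep (q s : ℝ) (i : ℤ × ℤ) : OU q := ((uUnit q ^ i.1 : (OU q)ˣ) : OU q) * rep q s i.2

lemma commute_u (x : OU q) : Commute (u q) x := by
  induction x using induction_on with
  | algebraMap z => exact (Algebra.commutes _ _).symm
  | gen g => exact u_central q g
  | mul x y hx hy => exact hx.mul_right hy
  | add x y hx hy => exact hx.add_right hy

lemma commute_zpow (m : ℤ) (x : OU q) : Commute ((uUnit q ^ m : (OU q)ˣ) : OU q) x :=
  Commute.units_zpow_left (u := uUnit q) (commute_u x) m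

lemma π_gRep (i : ℤ × ℤ) : π q s (gRep q s i) =
    rightMul q s ((uUnit q ^ i.1 : (OU q)ˣ) : OU q) (π q s (rep q s i.2)) := by
  rw [rightMul_π, gRep, (commute_zpow _ _).eq]

lemma isGroupLikeElem_gRep (hq : q ≠ 0) (i : ℤ × ℤ) :
    IsGroupLikeElem ℂ (π q s (gRep q s i)) := by
  have hm := isGroupLikeElem_zpow q i.1
  rw [gRep, (commute_zpow _ _).eq]
  refine isGroupLikeElem_π_mul (isGroupLikeElem_rep hq i.2) hm.counit_eq_one ?_
  rw [← comul_apply, hm.comul_eq_tmul_self, Algebra.TensorProduct.tmul_mul_tmul]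

end groupLike

/-! ### Spanning -/

section span

variable {q s : ℝ}

lemma rightMul_zpow_gRep (k : ℤ) (i : ℤ × ℤ) :
    rightMul q s ((uUnit q ^ k : (OU q)ˣ) : OU q) (π q s (gRep q s i)) =
      π q s (gRep q s (i.1 + k, i.2)) := by
  rw [π_gRep, π_gRep, ← rightMul_mul, ← Units.val_mul, ← zpow_add]

lemma rightMul_u_gRep (i : ℤ × ℤ) : rightMul q s (u q) (π q s (gRep q s i)) =
    π q s (gRep q s (i.1 + 1, i.2)) := by
  simpa [uUnit] using rightMul_zpow_gRep (s := s) (q := q) 1 i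

lemma rightMul_uStar_gRep (i : ℤ × ℤ) : rightMul q s (star (u q)) (π q s (gRep q s i)) =
    π q s (gRep q s (i.1 - 1, i.2)) := by
  simpa [uUnit, sub_eq_add_neg] using rightMul_zpow_gRep (s := s) (q := q) (-1) i

lemma rightMul_gRep (h : OU q) (i : ℤ × ℤ) : rightMul q s h (π q s (gRep q s i)) =
    rightMul q s ((uUnit q ^ i.1 : (OU q)ˣ) : OU q) (rightMul q s h (π q s (rep q s i.2))) := by
  rw [π_gRep, ← rightMul_mul, ← rightMul_mul, (commute_zpow _ _).eq]

lemma rightMul_raising_gRep (hq : q ≠ 0) (i : ℤ × ℤ) :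
    rightMul q s (raising q ((q : ℂ) ^ i.2 * s)) (π q s (gRep q s i)) =
      π q s (gRep q s (i.1, i.2 + 1)) := by
  rw [rightMul_gRep, rightMul_raising_rep hq, π_gRep]

lemma rightMul_lowering_gRep (hq : q ≠ 0) (i : ℤ × ℤ) :
    rightMul q s (lowering q ((q : ℂ) ^ i.2 * s)) (π q s (gRep q s i)) =
      π q s (gRep q s (i.1, i.2 - 1)) := by
  rw [rightMul_gRep, rightMul_lowering_rep hq, π_gRep]

/-- Reality of `q` and `s` is essential here: the square is nonnegative. -/
lemma one_add_sq_ne_zero (q s : ℝ) (n : ℤ) : 1 + ((q : ℂ) ^ n * s) ^ 2 ≠ 0 := by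
  have h : (1 + (q ^ n * s) ^ 2 : ℝ) ≠ 0 := by positivity
  exact_mod_cast h

/-- The span of the elements `π (gRep q s i)`. -/
def gSpan (q s : ℝ) : Submodule ℂ (D q s) :=
  Submodule.span ℂ (Set.range fun i => π q s (gRep q s i))

lemma gRep_mem (i : ℤ × ℤ) : π q s (gRep q s i) ∈ gSpan q s :=
  Submodule.subset_span ⟨i, rfl⟩

lemma rightMul_mem_of_gRep {h : OU q} (hh : ∀ i, rightMul q s h (π q s (gRep q s i)) ∈ gSpan q s)
    {v : D q s} (hv : v ∈ gSpan q s) : rightMul q s h v ∈ gSpan q s := by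
  have : gSpan q s ≤ (gSpan q s).comap (rightMul q s h) :=
    Submodule.span_le.2 (by rintro _ ⟨i, rfl⟩; exact hh i)
  exact this hv

lemma rightMul_c_mem (hq : q ≠ 0) {v : D q s} (hv : v ∈ gSpan q s) :
    rightMul q s (γ q) v ∈ gSpan q s := by
  refine rightMul_mem_of_gRep (fun i => ?_) hv
  set r : ℂ := (q : ℂ) ^ i.2 * s with hr
  have hZ : rightMul q s (annihilator q r) (π q s (gRep q s i)) = 0 := by
    rw [rightMul_gRep, rightMul_annihilator_rep hq, map_zero]
  -- The identity determines `γu`; the further factor `u⋆` turns it into `γ`.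
  have h := congrArg (fun h => rightMul q s (star (u q)) (rightMul q s h (π q s (gRep q s i))))
    (smul_raising_sub_lowering q r)
  have hu : γ q * u q * star (u q) = γ q := by
    rw [mul_assoc, show u q * star (u q) = 1 from (uUnit q).val_inv, mul_one]
  simp only [rightMul_add, hZ, zero_add, rightMul_smul, rightMul_sub, map_smul, map_sub] at h
  rw [← rightMul_mul (γ q * u q) (star (u q)), hu, rightMul_mul, rightMul_raising_gRep hq,
    rightMul_lowering_gRep hq, rightMul_u_gRep, rightMul_uStar_gRep, rightMul_uStar_gRep] at h
  refine ((gSpan q s).smul_mem_iff (one_add_sq_ne_zero q s i.2)).1 ?_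
  rw [← hr, ← h]
  exact (gSpan q s).smul_mem _ (sub_mem (gRep_mem _) (gRep_mem _))

lemma rightMul_u_mem {v : D q s} (hv : v ∈ gSpan q s) : rightMul q s (u q) v ∈ gSpan q s :=
  rightMul_mem_of_gRep (fun i => by rw [rightMul_u_gRep]; exact gRep_mem _) hv

lemma rightMul_gen_mem (hq : q ≠ 0) (g : Gen) {v : D q s} (hv : v ∈ gSpan q s) :
    rightMul q s (gen q g) v ∈ gSpan q s := by
  refine rightMul_mem_of_gRep (fun i => ?_) hv
  have hi := gRep_mem (q := q) (s := s) i
  have hc := rightMul_c_mem hq hi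
  have hcu : rightMul q s (γ q * u q) (π q s (gRep q s i)) ∈ gSpan q s := by
    rw [rightMul_mul]; exact rightMul_u_mem hc
  cases g with
  | u => exact rightMul_u_mem hi
  | uStar =>
    have := rightMul_uStar_gRep (q := q) (s := s) i
    rw [u, star_gen, Gen.adj] at this
    rw [this]
    exact gRep_mem _
  | c => exact hc
  | a =>
    have h := rightMul_raising_gRep (s := s) hq i
    rw [raising, rightMul_add, rightMul_smul, ← eq_sub_iff_add_eq] at h
    change rightMul q s (α q) _ ∈ _
    rw [h]
    exact sub_mem (gRep_mem _) ((gSpan q s).smul_mem _ hc)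
  | aStar =>
    have h := rightMul_lowering_gRep (s := s) hq i
    rw [lowering, rightMul_sub, rightMul_smul, sub_eq_iff_eq_add, α, star_gen, Gen.adj] at h
    rw [h]
    exact add_mem (gRep_mem _) ((gSpan q s).smul_mem _ hcu)
  | cStar =>
    -- Since `Nu = γu + qγ⋆` acts by zero, `γ⋆` acts as `-q⁻¹γu`.
    have h := rightMul_u_mem (rightMul_normalElt (s := s) hq (π q s (gRep q s i)) ▸
      (gSpan q s).zero_mem)
    have hu : star (γ q) * star (u q) * u q = star (γ q) := by
      rw [mul_assoc, show star (u q) * u q = 1 from (uUnit q).inv_val, mul_one]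
    rw [normalElt, rightMul_add, map_add, rightMul_smul, map_smul, ← rightMul_mul,
      ← rightMul_mul, hu, γ, star_gen, Gen.adj] at h
    exact ((gSpan q s).smul_mem_iff (ofReal_ne_zero hq)).1 (((gSpan q s).add_mem_iff_right hcu).1 h)

lemma gSpan_eq_top (hq : q ≠ 0) : gSpan q s = ⊤ := by
  rw [eq_top_iff]
  rintro v -
  obtain ⟨x, rfl⟩ := π_surjective v
  have key : ∀ v ∈ gSpan q s, rightMul q s x v ∈ gSpan q s := by
    induction x using induction_on with
    | algebraMap z =>
      intro v hv
      rw [Algebra.algebraMap_eq_smul_one, rightMul_smul, rightMul_one]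
      exact (gSpan q s).smul_mem _ hv
    | gen g => exact fun v => rightMul_gen_mem hq g
    | mul x y hx hy =>
      intro v hv
      rw [rightMul_mul]
      exact hy _ (hx _ hv)
    | add x y hx hy =>
      intro v hv
      rw [rightMul_add]
      exact add_mem (hx _ hv) (hy _ hv)
  have h := key _ (gRep_mem (0, 0))
  rwa [rightMul_π, gRep, rep_zero, zpow_zero, Units.val_one, one_mul, one_mul] at h

end span

/-! ### The dual representation on functions -/

section action

variable (q s : ℝ)

/-- The parameter `qⁿs`. -/
def param (n : ℤ) : ℂ := (q : ℂ) ^ n * s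

/-- The operators on functions on `ℤ × ℤ` by which the generators act. They are dual to right
multiplication on the group-like elements of the quotient coalgebra. -/
def actionGen : Gen → Module.End ℂ (ℤ → ℤ → ℂ)
  | .u =>
    { toFun f m n := f (m + 1) n
      map_add' _ _ := rfl
      map_smul' _ _ := rfl }
  | .uStar =>
    { toFun f m n := f (m - 1) n
      map_add' _ _ := rfl
      map_smul' _ _ := rfl }
  | .a =>
    { toFun f m n := (f m (n + 1) + param q s n ^ 2 * f (m - 1) (n - 1)) / (1 + param q s n ^ 2)
      map_add' f g := by ext; simp; ring
      map_smul' z f := by ext; simp; ring }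
  | .aStar =>
    { toFun f m n := (f m (n - 1) + param q s n ^ 2 * f (m + 1) (n + 1)) / (1 + param q s n ^ 2)
      map_add' f g := by ext; simp; ring
      map_smul' z f := by ext; simp; ring }
  | .c =>
    { toFun f m n := param q s n * (f m (n + 1) - f (m - 1) (n - 1)) / (1 + param q s n ^ 2)
      map_add' f g := by ext; simp; ring
      map_smul' z f := by ext; simp; ring }
  | .cStar =>
    { toFun f m n :=
        -(param q s n * (f (m + 1) (n + 1) - f m (n - 1))) / (q * (1 + param q s n ^ 2))
      map_add' f g := by ext; simp; ring
      map_smul' z f := by ext; simp; ring }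

variable (f : ℤ → ℤ → ℂ) (m n : ℤ)

lemma actionGen_u : actionGen q s .u f m n = f (m + 1) n := rfl

lemma actionGen_uStar : actionGen q s .uStar f m n = f (m - 1) n := rfl

lemma actionGen_a : actionGen q s .a f m n =
    (f m (n + 1) + param q s n ^ 2 * f (m - 1) (n - 1)) / (1 + param q s n ^ 2) := rfl

lemma actionGen_aStar : actionGen q s .aStar f m n =
    (f m (n - 1) + param q s n ^ 2 * f (m + 1) (n + 1)) / (1 + param q s n ^ 2) := rfl

lemma actionGen_c : actionGen q s .c f m n =
    param q s n * (f m (n + 1) - f (m - 1) (n - 1)) / (1 + param q s n ^ 2) := rfl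

lemma actionGen_cStar : actionGen q s .cStar f m n =
    -(param q s n * (f (m + 1) (n + 1) - f m (n - 1))) / (q * (1 + param q s n ^ 2)) := rfl

variable {q}

lemma one_add_param_sq_ne_zero : 1 + param q s n ^ 2 ≠ 0 := one_add_sq_ne_zero q s n

lemma param_add_one (hq : q ≠ 0) : param q s (n + 1) = q * param q s n := by
  rw [param, param, zpow_add_one₀ (ofReal_ne_zero hq)]; ring

lemma param_sub_one (hq : q ≠ 0) : param q s (n - 1) = param q s n / q := by
  rw [param, param, zpow_sub_one₀ (ofReal_ne_zero hq)]; ring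

lemma one_add_sq_mul_param_sq_ne_zero (hq : q ≠ 0) : 1 + (q : ℂ) ^ 2 * param q s n ^ 2 ≠ 0 := by
  rw [← mul_pow, ← param_add_one s n hq]
  exact one_add_param_sq_ne_zero s (n + 1)

lemma sq_add_param_sq_ne_zero (hq : q ≠ 0) : (q : ℂ) ^ 2 + param q s n ^ 2 ≠ 0 := by
  have h := one_add_param_sq_ne_zero (q := q) s (n - 1)
  rw [param_sub_one s n hq, div_pow, one_add_div (pow_ne_zero 2 (ofReal_ne_zero hq))] at h
  exact (div_ne_zero_iff.1 h).1

/-- Each relation is checked pointwise. The words have length at most two, so only the denominators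
at `n` and `n ± 1` appear. -/
lemma actionGen_rel (hq : q ≠ 0) ⦃x y : Free⦄ (h : Rel q x y) :
    FreeAlgebra.lift ℂ (actionGen q s) x = FreeAlgebra.lift ℂ (actionGen q s) y := by
  have hq' := ofReal_ne_zero hq
  cases h
  case' u_central x => cases x
  case' uStar_central x => cases x
  all_goals
    refine LinearMap.ext fun f => funext fun m => funext fun n => ?_
    have h₀ := one_add_param_sq_ne_zero (q := q) s n
    have h₁ := one_add_sq_mul_param_sq_ne_zero s n hq
    have h₂ := sq_add_param_sq_ne_zero s n hq
    have h₁' : 1 + param q s n ^ 2 * (q : ℂ) ^ 2 ≠ 0 := by rwa [mul_comm]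
    simp only [map_mul, map_add, map_smul, map_one, FreeAlgebra.lift_ι_apply, Module.End.mul_apply,
      LinearMap.add_apply, LinearMap.smul_apply, Module.End.one_apply, Pi.add_apply, Pi.smul_apply,
      smul_eq_mul, actionGen_u, actionGen_uStar, actionGen_a, actionGen_aStar, actionGen_c,
      actionGen_cStar, param_add_one s n hq, param_sub_one s n hq, add_sub_cancel_right,
      sub_add_cancel]
    try field_simp
    try ring_nf

end action

/-! ### Linear independence and the basis -/

section separation

variable {q : ℝ} (s : ℝ)

/-- The left action of `𝒪(U_q(2))` on functions on `ℤ × ℤ`. -/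
def action (hq : q ≠ 0) : OU q →ₐ[ℂ] Module.End ℂ (ℤ → ℤ → ℂ) :=
  lift (actionGen q s) (actionGen_rel s hq)

variable (hq : q ≠ 0) (f : ℤ → ℤ → ℂ) (m n : ℤ)

lemma action_gen (g : Gen) : action s hq (gen q g) = actionGen q s g := lift_gen _ _ _

lemma action_raising :
    action s hq (raising q ((q : ℂ) ^ n * s)) f m n = f m (n + 1) := by
  have h₀ := one_add_param_sq_ne_zero (q := q) s n
  rw [raising, ← param]
  simp only [α, γ, map_add, map_smul, action_gen, LinearMap.add_apply, LinearMap.smul_apply,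
    Pi.add_apply, Pi.smul_apply, smul_eq_mul, actionGen_a, actionGen_c]
  field_simp
  ring

lemma action_lowering :
    action s hq (lowering q ((q : ℂ) ^ n * s)) f m n = f m (n - 1) := by
  have h₀ := one_add_param_sq_ne_zero (q := q) s n
  rw [lowering, ← param]
  simp only [u, α, γ, star_gen, Gen.adj, map_sub, map_smul, map_mul, action_gen,
    LinearMap.sub_apply, LinearMap.smul_apply, Module.End.mul_apply, Pi.sub_apply, Pi.smul_apply,
    smul_eq_mul, actionGen_aStar, actionGen_c, actionGen_u, sub_add_cancel]
  field_simp
  ring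

/-- The last factor of `rep` acts on `f` first, so the induction must allow `f` to change. -/
lemma action_rep : action s hq (rep q s n) f m 0 = f m n := by
  induction n using Int.induction_on generalizing f with
  | zero => rw [rep_zero, map_one]; rfl
  | succ n ih =>
    rw [rep_natCast_add_one, map_mul, Module.End.mul_apply, ih, action_raising]
  | pred n ih =>
    rw [rep_neg_natCast_sub_one, map_mul, Module.End.mul_apply, ih, action_lowering]

lemma action_zpow (k : ℤ) :
    action s hq ((uUnit q ^ k : (OU q)ˣ) : OU q) f m n = f (m + k) n := by
  induction k using Int.induction_on generalizing f with
  | zero => simp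
  | succ k ih =>
    rw [zpow_add_one, Units.val_mul, map_mul, Module.End.mul_apply, ih, ← add_assoc]
    exact congrFun (congrFun (congrArg (· f) (action_gen s hq .u)) _) _
  | pred k ih =>
    rw [zpow_sub_one, Units.val_mul, map_mul, Module.End.mul_apply, ih, ← add_sub_assoc]
    have : ((uUnit q)⁻¹ : (OU q)ˣ) = gen q .uStar := star_gen q .u
    rw [this]
    exact congrFun (congrFun (congrArg (· f) (action_gen s hq .uStar)) _) _

lemma action_gRep (i : ℤ × ℤ) : action s hq (gRep q s i) f 0 0 = f i.1 i.2 := by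
  rw [gRep, map_mul, Module.End.mul_apply, action_zpow, action_rep, zero_add]

lemma action_mem_J {x : OU q} (hx : x ∈ J q s) : action s hq x f 0 0 = 0 := by
  have hq' := ofReal_ne_zero hq
  have h₀ := one_add_param_sq_ne_zero (q := q) s 0
  have h₁ := one_add_sq_mul_param_sq_ne_zero s 0 hq
  have h₂ := sq_add_param_sq_ne_zero s 0 hq
  have hp : param q s 0 = s := by simp [param]
  rw [hp] at h₀ h₁ h₂
  have h₁' : 1 + (s : ℂ) ^ 2 * (q : ℂ) ^ 2 ≠ 0 := by rwa [mul_comm]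
  -- Quantifying over `f` handles right multiples: `x * h` acts on `f` as `x` acts on the function
  -- `h` sends `f` to. Only the three generators need computation.
  refine Submodule.span_induction (p := fun x _ => ∀ f, action s hq x f 0 0 = 0)
    ?_ (by simp) ?_ ?_ hx f
  · rintro y (rfl | rfl | rfl) f
    case' inr.inr => rw [star_zeta]
    all_goals
      simp only [xi, zeta, u, α, γ, star_gen, Gen.adj, sq (gen q _),
        Algebra.algebraMap_eq_smul_one, map_mul, map_add, map_sub, map_smul, map_one,
        action_gen, Module.End.mul_apply, LinearMap.add_apply, LinearMap.sub_apply,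
        LinearMap.smul_apply, Module.End.one_apply, Pi.add_apply, Pi.sub_apply, Pi.smul_apply,
        smul_eq_mul, actionGen_u, actionGen_uStar, actionGen_a, actionGen_aStar, actionGen_c,
        actionGen_cStar, param_add_one s 0 hq, param_sub_one s 0 hq, hp, add_sub_cancel_right,
        sub_add_cancel]
      field_simp
      ring_nf
  · intro x y _ _ hx hy f
    rw [map_add, LinearMap.add_apply, Pi.add_apply, Pi.add_apply, hx, hy, add_zero]
  · intro h x _ hx f
    rw [← MulOpposite.op_unop h, MulOpposite.smul_eq_mul_unop, map_mul, Module.End.mul_apply, hx]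

/-- The functional on the quotient coalgebra induced by a function on `ℤ × ℤ`. -/
def functional : D q s →ₗ[ℂ] ℂ :=
  (J q s).liftQ
    (LinearMap.proj (R := ℂ) (φ := fun _ : ℤ => ℂ) 0 ∘ₗ
      LinearMap.proj (R := ℂ) (φ := fun _ : ℤ => ℤ → ℂ) 0 ∘ₗ
        LinearMap.applyₗ f ∘ₗ (action s hq).toLinearMap)
    fun _ hx => LinearMap.mem_ker.2 (action_mem_J s hq f hx)

lemma functional_gRep (i : ℤ × ℤ) : functional s hq f (π q s (gRep q s i)) = f i.1 i.2 :=
  action_gRep s hq f i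

lemma linearIndependent_gRep (hq : q ≠ 0) :
    LinearIndependent ℂ fun i => π q s (gRep q s i) := by
  refine LinearIndependent.of_pairwise_dual_eq_zero_one _
    (fun i => functional s hq fun m n => if (m, n) = i then 1 else 0) ?_ ?_
  · intro i j hij
    rw [functional_gRep]
    exact if_neg hij.symm
  · intro i
    rw [functional_gRep]
    exact if_pos rfl

/-- The basis of group-like elements of the quotient coalgebra. -/
def groupLikeBasis (hq : q ≠ 0) : Module.Basis (ℤ × ℤ) ℂ (D q s) :=
  Module.Basis.mk (linearIndependent_gRep s hq) (gSpan_eq_top hq).ge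

lemma groupLikeBasis_apply (i : ℤ × ℤ) : groupLikeBasis s hq i = π q s (gRep q s i) :=
  Module.Basis.mk_apply _ _ _

end separation

/-! ### The two product formulas -/

section equality

variable {q s : ℝ}

/-- As `J` is only a right ideal, congruence modulo `J` would not allow replacing an inner factor;
equality of the operators on all of `D` does. -/
lemma π_mul_orderedProd_congr {x y : ℕ → OU q}
    (h : ∀ k (v : D q s), rightMul q s (x k) v = rightMul q s (y k) v) (z : OU q) (n : ℕ) :
    π q s (z * orderedProd n x) = π q s (z * orderedProd n y) := by
  induction n with
  | zero => rfl
  | succ n ih =>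
    rw [orderedProd_succ, orderedProd_succ, ← mul_assoc, ← mul_assoc, ← rightMul_π, ih, h,
      rightMul_π]

/-- The two factors differ by `rN`, which acts by zero. -/
lemma rightMul_raising_eq (hq : q ≠ 0) (r : ℂ) (v : D q s) :
    rightMul q s (raising q r) v =
      rightMul q s (α q - ((q : ℂ) * r) • (star (γ q) * star (u q))) v := by
  have h : raising q r = α q - ((q : ℂ) * r) • (star (γ q) * star (u q)) + r • normalElt q := by
    rw [raising, normalElt]; module
  rw [h, rightMul_add, rightMul_smul, rightMul_normalElt hq, smul_zero, add_zero]

lemma rightMul_lowering_eq (hq : q ≠ 0) (r : ℂ) (v : D q s) :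
    rightMul q s (lowering q r) v =
      rightMul q s (star (α q) + ((q : ℂ) * r) • star (γ q)) v := by
  have hu : star (γ q) * star (u q) * u q = star (γ q) := by
    rw [mul_assoc, show star (u q) * u q = 1 from (uUnit q).inv_val, mul_one]
  have h : lowering q r = star (α q) + ((q : ℂ) * r) • star (γ q) - r • (normalElt q * u q) := by
    rw [lowering, normalElt, add_mul, smul_mul_assoc, hu]; module
  rw [h, rightMul_sub, rightMul_smul, rightMul_mul, rightMul_normalElt hq, map_zero, smul_zero,
    sub_zero]

end equality

end QuantumU2.OU

/-! ### Coalgebras with a group-like basis -/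

namespace Module.Basis

variable {R ι M : Type*} [CommSemiring R] [AddCommMonoid M] [Module R M] [Coalgebra R M]

/-- A basis of group-like elements, indexed by an additive monoid, identifies a coalgebra with the
coalgebra of the monoid algebra. -/
def coalgEquivOfGroupLike [AddMonoid ι] (b : Basis ι R M) (hb : ∀ i, IsGroupLikeElem R (b i)) :
    M ≃ₗc[R] AddMonoidAlgebra R ι :=
  { b.equiv (AddMonoidAlgebra.basis ι R) (Equiv.refl ι) with
    counit_comp := b.ext fun i => by simp [(hb i).counit_eq_one]
    map_comp_comul := b.ext fun i => by
      simp [(hb i).comul_eq_tmul_self] }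

lemma coalgEquivOfGroupLike_apply [AddMonoid ι] (b : Basis ι R M)
    (hb : ∀ i, IsGroupLikeElem R (b i)) (i : ι) :
    b.coalgEquivOfGroupLike hb (b i) = AddMonoidAlgebra.single i 1 :=
  (b.equiv_apply _ _ _).trans (AddMonoidAlgebra.basis_apply _ _)

end Module.Basis
end

open QuantumU2.OU in
theorem proposition3p1 (q s : ℝ) (hq : q ≠ 0) (hs₀ : 0 ≤ s) (hs₁ : s ≤ 1) :
    ∃ d : Module.Basis (ℤ × ℤ) ℂ (D q s),
      (∀ m n : ℤ, IsGroupLikeElem ℂ (d (m, n))) ∧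
      (∀ (m : ℤ) (n : ℕ), 0 < n →
        d (m, (n : ℤ)) = π q s (((uUnit q ^ m : (OU q)ˣ) : OU q) *
          orderedProd n fun k => α q - ((q : ℂ) ^ (k + 1) * (s : ℂ)) • (star (γ q) * star (u q))) ∧
        d (m, (n : ℤ)) = π q s (((uUnit q ^ m : (OU q)ˣ) : OU q) *
          orderedProd n fun k => α q + ((q : ℂ) ^ k * (s : ℂ)) • γ q)) ∧
      (∀ m : ℤ, d (m, 0) = π q s ((uUnit q ^ m : (OU q)ˣ) : OU q)) ∧
      (∀ (m : ℤ) (n : ℕ), 0 < n →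
        d (m, -(n : ℤ)) = π q s (((uUnit q ^ m : (OU q)ˣ) : OU q) *
          orderedProd n fun k =>
            star (α q) + ((q : ℂ) ^ (1 - (k : ℤ)) * (s : ℂ)) • star (γ q)) ∧
        d (m, -(n : ℤ)) = π q s (((uUnit q ^ m : (OU q)ˣ) : OU q) *
          orderedProd n fun k =>
            star (α q) - ((q : ℂ) ^ (-(k : ℤ)) * (s : ℂ)) • (γ q * u q))) ∧
      ∃ φ : D q s ≃ₗc[ℂ] OTorus2, ∀ m n : ℤ, φ (d (m, n)) = torusMonomial m n := by
  have hg : ∀ i, IsGroupLikeElem ℂ (groupLikeBasis s hq i) := fun i => by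
    rw [groupLikeBasis_apply]
    exact isGroupLikeElem_gRep hq i
  have hpos : ∀ (m : ℤ) (n : ℕ), groupLikeBasis s hq (m, (n : ℤ)) =
      π q s (((uUnit q ^ m : (OU q)ˣ) : OU q) *
        orderedProd n fun k => raising q ((q : ℂ) ^ k * s)) := fun m n => by
    rw [groupLikeBasis_apply, gRep, rep_natCast]
  have hneg : ∀ (m : ℤ) (n : ℕ), groupLikeBasis s hq (m, -(n : ℤ)) =
      π q s (((uUnit q ^ m : (OU q)ˣ) : OU q) *
        orderedProd n fun k => lowering q ((q : ℂ) ^ (-(k : ℤ)) * s)) := fun m n => by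
    rw [groupLikeBasis_apply, gRep, rep_neg_natCast]
  refine ⟨groupLikeBasis s hq, fun m n => hg _, fun m n _ => ⟨?_, hpos m n⟩, fun m => ?_,
    fun m n _ => ⟨?_, hneg m n⟩, (groupLikeBasis s hq).coalgEquivOfGroupLike hg,
    fun m n => (groupLikeBasis s hq).coalgEquivOfGroupLike_apply hg _⟩
  · rw [hpos]
    refine π_mul_orderedProd_congr (fun k v => ?_) _ n
    -- The `q` in `N = γ + qγ⋆u⋆` shifts the exponent from `k` to `k + 1`.
    rw [rightMul_raising_eq hq, ← mul_assoc, ← pow_succ']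
  · rw [groupLikeBasis_apply, gRep, rep_zero, mul_one]
  · rw [hneg]
    refine π_mul_orderedProd_congr (fun k v => ?_) _ n
    rw [rightMul_lowering_eq hq, ← mul_assoc, ← zpow_one_add₀ (ofReal_ne_zero hq), sub_eq_add_neg]
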